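/- Let $H$ be an infinite-dimensional separable real Hilbert space with complete orthonormal system $(e_n)_{n\ge1}$, and let $(\Omega,\mathcal F,\mathbb P)$ be a probability space. Let $(\beta^n)_{n\ge1}$ be independent real Brownian motions and let $L=(L_t)_{t\ge0}$ be a strictly $\alpha$-stable subordinator, $\alpha\in(0,1)$, independent of $(\beta^n)_n$; that is, $L$ is an increasing Lévy process with $$\mathbb E\big[e^{iuL_1}\big]=\exp\Big\{-\bar c\,|u|^\alpha\Big(1-i\tan\tfrac{\pi\alpha}{2}\,\mathrm{sign}(u)\Big)\Big\},\qquad u\in\mathbb R,$$ for some $\bar c>0$. Put $c'=\bar c/\cos(\pi\alpha/2)$. Then $\mathbb E[e^{-uL_1}]=e^{-c'u^\alpha}$ for all $u\ge0$, and the following hold. 1. For every $h\in H$ and $t>0$, the series $\sum_{n=1}^\infty\beta^n_{L_t}\langle h,e_n\rangle$ converges in distribution to a real, symmetric, $2\alpha$-stable random variable $X_t$ (equal to $0$ if $h=0$) with $$\mathbb E\big[e^{iuX_t}\big]=\exp\Big\{-t\,\frac{c'}{2^\alpha}\,\|h\|_H^{2\alpha}\,|u|^{2\alpha}\Big\},\qquad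 u\in\mathbb R.$$ 2. Let $Q:H\to H$ be a linear, bounded, nonnegative definite operator with $Qe_n=\sigma_n^2e_n$, $\sigma_n\ge0$, for all $n$, and let $\sqrt Q$ be its unique nonnegative definite square root. Let $(\rho_n)_n$ be a bounded sequence of strictly positive numbers such that $\sum_{n=1}^\infty\rho_n^{2r}\sigma_n^{2r}<\infty$ for some $0<r<\alpha$. Put $$V=\Big\{h\in H:\ \sum_{n=1}^\infty\rho_n^{-2}|\langle h,e_n\rangle|^2<\infty\Big\},\qquad \langle v,w\rangle_V=\sum_{n=1}^\infty\rho_n^{-2}\langle v,e_n\rangle\langle w,e_n\rangle ,$$ and regard $h\in H$ as the element $\langle h,\cdot\rangle_{V',V}=\sum_{n}\langle h,e_n\rangle\langle\cdot,e_n\rangle$ of the dual space $V'$ of $V$. Then $V$ is a Hilbert space, continuously and densely embedded in $H$, and for every $t>0$ there is a random variable $\sqrt QW_{L_t}:\Omega\to V'$ such that $$\sqrt QW_{L_t}=\lim_{N\to\infty}\sum_{n=1}^N\sigma_n\beta^n_{L_t}e_n\quad\text{in the norm of }V',\ \mathbb P\text{-a.s.}$$ In particular, $\mathbb P$-a.s.,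 for every $v\in V$, $$\sum_{n=1}^N\beta^n_{L_t}\langle\sqrt Qv,e_n\rangle\ \underset{N\to\infty}{\longrightarrow}\ \langle\sqrt QW_{L_t},v\rangle_{V',V}.$$ -/

import Mathlib

open MeasureTheory ProbabilityTheory Filter Topology
open scoped NNReal ENNReal

noncomputable section

/-! ### Lévy processes, stable subordinators, symmetric stable laws -/

/-- A real-valued Lévy process, indexed by `[0, ∞)`. -/
structure IsLevyProcess {Ω : Type*} [MeasurableSpace Ω] (L : ℝ≥0 → Ω → ℝ) (P : Measure Ω) :
    Prop where
  aemeasurable : ∀ t, AEMeasurable (L t) P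
  zero : ∀ᵐ ω ∂P, L 0 ω = 0
  indep : HasIndepIncrements L P
  stationary : ∀ s t : ℝ≥0, P.map (fun ω => L (s + t) ω - L s ω) = P.map (L t)
  stochCont : ∀ t, TendstoInMeasure P L (𝓝 t) (L t)
  cadlag : ∀ᵐ ω ∂P, ∀ t : ℝ≥0, ContinuousWithinAt (fun s => L s ω) (Set.Ici t) t ∧
    ∃ l : ℝ, Tendsto (fun s => L s ω) (𝓝[<] t) (𝓝 l)

/-- A strictly `α`-stable subordinator with scale constant `c`: an increasing Lévy process whose
value at time `1` has characteristic function
`exp (-c |u|^α (1 - i tan (π α / 2) sign u))`. -/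
structure IsStableSubordinator {Ω : Type*} [MeasurableSpace Ω] (α c : ℝ) (L : ℝ≥0 → Ω → ℝ)
    (P : Measure Ω) : Prop where
  levy : IsLevyProcess L P
  mono : ∀ᵐ ω ∂P, Monotone (fun t => L t ω)
  charFun_one : ∀ u : ℝ, charFun (P.map (L 1)) u =
    Complex.exp (-((c * |u| ^ α : ℝ) : ℂ) *
      (1 - Complex.I * ((Real.tan (Real.pi * α / 2) * Real.sign u : ℝ) : ℂ)))

/-- The constant `c'` in the Laplace transform `exp (-c' u^α)` of the value at time `1` of a
strictly `α`-stable subordinator with scale constant `c`. -/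
def laplaceConst (α c : ℝ) : ℝ := c / Real.cos (Real.pi * α / 2)

/-- The time change `B_{L_t}`. Subordinators are almost surely nonnegative, so that `toNNReal`
only changes the type. -/
def subordinate {Ω : Type*} (B : ℝ≥0 → Ω → ℝ) (L : ℝ≥0 → Ω → ℝ) (t : ℝ≥0) (ω : Ω) : ℝ :=
  B (L t ω).toNNReal ω

/-- A probability measure on `ℝ` is symmetric `a`-stable: it is invariant under `x ↦ -x`, and
whenever `X₁, X₂, X` are distributed according to it with `X₁, X₂` independent, and `A, B > 0`,
the variable `A X₁ + B X₂` has the law of `(A^a + B^a)^(1/a) X + D` for some constant `D`. -/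
structure IsSymmetricStable (a : ℝ) (ν : Measure ℝ) : Prop where
  symm : ν.map (fun x => -x) = ν
  stable : ∀ A B : ℝ, 0 < A → 0 < B → ∃ D : ℝ,
    (ν.map (fun x => A * x)) ∗ (ν.map (fun x => B * x)) =
      ν.map (fun x => (A ^ a + B ^ a) ^ (1 / a) * x + D)

/-! ### The weighted space `V` and the Gelfand triple `V ⊂ H ⊂ V'` -/

/-- A bounded sequence of strictly positive weights. -/
structure BoundedWeight where
  w : ℕ → ℝ
  pos : ∀ n, 0 < w n
  bdd : ∃ M : ℝ, ∀ n, w n ≤ M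

section WeightedSpace

variable {H : Type*} [NormedAddCommGroup H] [InnerProductSpace ℝ H]

theorem summable_weighted_mul (e : HilbertBasis ℕ ℝ H) (ρ : BoundedWeight) {v w : H}
    (hv : Summable fun n => (ρ.w n ^ 2)⁻¹ * |inner ℝ v (e n)| ^ 2)
    (hw : Summable fun n => (ρ.w n ^ 2)⁻¹ * |inner ℝ w (e n)| ^ 2) :
    Summable fun n => (ρ.w n ^ 2)⁻¹ * (inner ℝ v (e n) * inner ℝ w (e n)) := by
  refine Summable.of_norm_bounded (hv.add hw) fun n => ?_
  have h1 : 0 ≤ (ρ.w n ^ 2)⁻¹ := by positivity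
  rw [Real.norm_eq_abs, abs_mul, abs_of_nonneg h1, ← mul_add, abs_mul]
  refine mul_le_mul_of_nonneg_left ?_ h1
  nlinarith [sq_nonneg (|inner ℝ v (e n)| - |inner ℝ w (e n)|),
    sq_nonneg |inner ℝ v (e n)|, sq_nonneg |inner ℝ w (e n)|]

/-- `V = {h ∈ H : ∑ ρ_n⁻² |⟨h, e_n⟩|² < ∞}` as a linear subspace of `H`. -/
def weightedSubmodule (e : HilbertBasis ℕ ℝ H) (ρ : BoundedWeight) : Submodule ℝ H where
  carrier := {h | Summable fun n => (ρ.w n ^ 2)⁻¹ * |inner ℝ h (e n)| ^ 2}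
  zero_mem' := by simp [summable_zero]
  add_mem' := by
    intro v w hv hw
    have h := (hv.add hw).add ((summable_weighted_mul e ρ hv hw).mul_left 2)
    refine h.congr fun n => ?_
    simp only [inner_add_left, sq_abs]
    ring
  smul_mem' := by
    intro c v hv
    refine (hv.mul_left (c ^ 2)).congr fun n => ?_
    simp only [real_inner_smul_left, sq_abs]
    ring

/-- The space `V` with its own inner product (not the one inherited from `H`). -/
def WeightedSpace (e : HilbertBasis ℕ ℝ H) (ρ : BoundedWeight) : Type _ :=
  weightedSubmodule e ρ

namespace WeightedSpace

variable (e : HilbertBasis ℕ ℝ H) (ρ : BoundedWeight)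

instance : AddCommGroup (WeightedSpace e ρ) :=
  inferInstanceAs (AddCommGroup (weightedSubmodule e ρ))

instance : Module ℝ (WeightedSpace e ρ) := inferInstanceAs (Module ℝ (weightedSubmodule e ρ))

/-- The inclusion `V → H` as a linear map. -/
def incl : WeightedSpace e ρ →ₗ[ℝ] H := (weightedSubmodule e ρ).subtype

theorem summable_sq (v : WeightedSpace e ρ) :
    Summable fun n => (ρ.w n ^ 2)⁻¹ * |inner ℝ (incl e ρ v) (e n)| ^ 2 := v.2

/-- `⟨v, w⟩_V = ∑ ρ_n⁻² ⟨v, e_n⟩ ⟨w, e_n⟩`. -/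
def innerV (v w : WeightedSpace e ρ) : ℝ :=
  ∑' n, (ρ.w n ^ 2)⁻¹ * (inner ℝ (incl e ρ v) (e n) * inner ℝ (incl e ρ w) (e n))

theorem summable_innerV (v w : WeightedSpace e ρ) :
    Summable fun n =>
      (ρ.w n ^ 2)⁻¹ * (inner ℝ (incl e ρ v) (e n) * inner ℝ (incl e ρ w) (e n)) :=
  summable_weighted_mul e ρ (summable_sq e ρ v) (summable_sq e ρ w)

theorem hasSum_norm_sq (h : H) : HasSum (fun n => inner ℝ h (e n) * inner ℝ h (e n)) (‖h‖ ^ 2) := by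
  have := e.hasSum_inner_mul_inner h h
  rw [real_inner_self_eq_norm_sq] at this
  have h2 : (fun n => inner ℝ h (e n) * inner ℝ h (e n)) =
      fun n => inner ℝ h (e n) * inner ℝ (e n) h := by
    funext n
    rw [real_inner_comm h (e n)]
  rw [h2]
  exact this

theorem exists_norm_sq_le : ∃ C : ℝ, 0 ≤ C ∧ ∀ v : WeightedSpace e ρ,
    ‖incl e ρ v‖ ^ 2 ≤ C ^ 2 * innerV e ρ v v := by
  obtain ⟨M, hM⟩ := ρ.bdd
  have hM0 : 0 ≤ M := (ρ.pos 0).le.trans (hM 0)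
  refine ⟨M, hM0, fun v => ?_⟩
  rw [innerV, ← tsum_mul_left, ← (hasSum_norm_sq e (incl e ρ v)).tsum_eq]
  refine (hasSum_norm_sq e (incl e ρ v)).summable.tsum_le_tsum (fun n => ?_)
    ((summable_innerV e ρ v v).mul_left _)
  rw [← mul_assoc]
  refine le_mul_of_one_le_left (mul_self_nonneg _) ?_
  have hp := ρ.pos n
  rw [← div_eq_mul_inv, one_le_div (by positivity)]
  exact pow_le_pow_left₀ hp.le (hM n) 2

/-- The axioms of an inner product for `⟨·, ·⟩_V`. -/
@[reducible]
def core : InnerProductSpace.Core ℝ (WeightedSpace e ρ) where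
  inner := innerV e ρ
  conj_inner_symm v w := by
    simp only [innerV, conj_trivial]
    exact tsum_congr fun n => by ring
  re_inner_nonneg v := by
    simp only [innerV, RCLike.re_to_real]
    exact tsum_nonneg fun n => mul_nonneg (by positivity) (mul_self_nonneg _)
  add_left u v w := by
    simp only [innerV]
    rw [← (summable_innerV e ρ u w).tsum_add (summable_innerV e ρ v w)]
    exact tsum_congr fun n => by rw [map_add, inner_add_left]; ring
  smul_left v w c := by
    simp only [innerV, conj_trivial]
    rw [← tsum_mul_left]
    exact tsum_congr fun n => by rw [map_smul, real_inner_smul_left]; ring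
  definite v hv := by
    obtain ⟨C, _, hC⟩ := exists_norm_sq_le e ρ
    have h := hC v
    change innerV e ρ v v = 0 at hv
    rw [hv, mul_zero] at h
    have h0 : incl e ρ v = 0 := by
      rw [← norm_eq_zero]
      exact pow_eq_zero_iff (two_ne_zero) |>.1 (le_antisymm h (sq_nonneg _))
    exact Subtype.ext h0

instance : NormedAddCommGroup (WeightedSpace e ρ) :=
  @InnerProductSpace.Core.toNormedAddCommGroup ℝ _ _ _ _ (core e ρ)

instance : InnerProductSpace ℝ (WeightedSpace e ρ) := InnerProductSpace.ofCore (core e ρ).toCore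

theorem inner_def (v w : WeightedSpace e ρ) : inner ℝ v w =
    ∑' n, (ρ.w n ^ 2)⁻¹ * (inner ℝ (incl e ρ v) (e n) * inner ℝ (incl e ρ w) (e n)) := rfl

theorem exists_norm_le : ∃ C : ℝ, ∀ v : WeightedSpace e ρ, ‖incl e ρ v‖ ≤ C * ‖v‖ := by
  obtain ⟨C, hC0, hC⟩ := exists_norm_sq_le e ρ
  refine ⟨C, fun v => ?_⟩
  have h := hC v
  have h2 : innerV e ρ v v = ‖v‖ ^ 2 := real_inner_self_eq_norm_sq v
  rw [h2, ← mul_pow] at h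
  exact le_of_sq_le_sq h (by positivity)

/-- The inclusion `V → H` as a bounded operator. -/
def inclL : WeightedSpace e ρ →L[ℝ] H := (incl e ρ).mkContinuousOfExistsBound (exists_norm_le e ρ)

/-- The map `H → V'` of the Gelfand triple: `h` is sent to the functional `⟨h, ·⟩_{V',V}`. -/
def toDual (h : H) : StrongDual ℝ (WeightedSpace e ρ) := (innerSL ℝ h).comp (inclL e ρ)

/-- `⟨h, v⟩_{V',V} = ∑ ⟨h, e_n⟩ ⟨v, e_n⟩`. -/
theorem toDual_apply (h : H) (v : WeightedSpace e ρ) : toDual e ρ h v =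
    ∑' n, inner ℝ h (e n) * inner ℝ (incl e ρ v) (e n) := by
  change inner ℝ h (incl e ρ v) = _
  rw [← (e.hasSum_inner_mul_inner h (incl e ρ v)).tsum_eq]
  exact tsum_congr fun n => by rw [real_inner_comm (incl e ρ v) (e n)]

end WeightedSpace

end WeightedSpace

/-- `R` is the positive square root of the nonnegative definite bounded operator `Q`. -/
def IsPositiveSqrt {H : Type*} [NormedAddCommGroup H] [InnerProductSpace ℝ H]
    (Q R : H →L[ℝ] H) : Prop :=
  R.IsPositive ∧ R.comp R = Q

end

/-!
Since `L` is independent of the Brownian motions, conditioning on `L_t = s` turns each finite sum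
`∑ β^n_{L_t} a_n` into a centred Gaussian variable of variance `s ∑ a_n²`. Its characteristic
function at `u` is therefore the Laplace transform of `L_t` at `u² (∑ a_n²) / 2`, which is
continuous in `∑ a_n²`, so Lévy's continuity theorem gives the convergence in distribution.

The Laplace transform comes from the prescribed characteristic function of `L_1`. As `L_1 ≥ 0`, both
`z ↦ 𝔼[exp (-z L_1)]` and `z ↦ exp (-c' z ^ α)` are holomorphic and bounded on the right half-plane
and agree on its boundary, so the Phragmén–Lindelöf principle identifies them. For other times,
`t ↦ log 𝔼[exp (-u L_t)]` is additive and monotone, hence linear.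

The diagonal operator `e_n ↦ ρ_n e_n` is an isometry of `H` onto `V`. Through it, convergence of
`∑ σ_n β^n_{L_t} e_n` in `V'` becomes convergence of `∑ (ρ_n σ_n β^n_{L_t})²`. At a deterministic
time the expectation of this series is finite; by independence, almost sure finiteness carries
over to the random time `L_t`.
-/

section DiagonalOperator

variable {ι 𝕜 H : Type*} [RCLike 𝕜] [NormedAddCommGroup H] [InnerProductSpace 𝕜 H]
  (e : HilbertBasis ι 𝕜 H)

theorem hilbertBasis_ext_inner {x y : H} (h : ∀ i, inner 𝕜 (e i) x = inner 𝕜 (e i) y) : x = y := by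
  refine e.repr.injective (lp.ext (funext fun i => ?_))
  simpa only [e.repr_apply_apply] using h i

theorem continuousLinearMap_ext_hilbertBasis {F : Type*} [NormedAddCommGroup F] [NormedSpace 𝕜 F]
    {A B : H →L[𝕜] F} (h : ∀ i, A (e i) = B (e i)) : A = B :=
  ContinuousLinearMap.ext_on (Submodule.dense_iff_topologicalClosure_eq_top.2 e.dense_span)
    (Set.forall_mem_range.2 h)

theorem exists_hasSum_smul_of_memℓp {a : ι → 𝕜} (ha : Memℓp a 2) :
    ∃ x : H, (∀ i, inner 𝕜 (e i) x = a i) ∧ HasSum (fun i => a i • e i) x :=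
  ⟨e.repr.symm ⟨a, ha⟩, fun i => by rw [← e.repr_apply_apply, e.repr.apply_symm_apply],
    e.hasSum_repr_symm ⟨a, ha⟩⟩

/-- The operator on a Hilbert space that is diagonal in the basis `e`, with the bounded family `a`
as diagonal entries. -/
noncomputable def diagonalOp (a : lp (fun _ : ι => 𝕜) ∞) : H →L[𝕜] H :=
  (e.repr.symm : lp (fun _ : ι => 𝕜) 2 →L[𝕜] H) ∘L
    lp.mapCLM 2 (fun i => ContinuousLinearMap.mul 𝕜 𝕜 (a i)) (norm_nonneg a)
      (fun i => (ContinuousLinearMap.opNorm_mul_apply_le 𝕜 𝕜 (a i)).trans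
        (lp.norm_apply_le_norm ENNReal.top_ne_zero a i)) ∘L
    (e.repr : H →L[𝕜] lp (fun _ : ι => 𝕜) 2)

theorem inner_diagonalOp (a : lp (fun _ : ι => 𝕜) ∞) (x : H) (i : ι) :
    inner 𝕜 (e i) (diagonalOp e a x) = a i * inner 𝕜 (e i) x := by
  rw [← e.repr_apply_apply, ← e.repr_apply_apply]
  simp [diagonalOp]

theorem diagonalOp_apply_basis (a : lp (fun _ : ι => 𝕜) ∞) (i : ι) :
    diagonalOp e a (e i) = a i • e i := by
  refine hilbertBasis_ext_inner e fun j => ?_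
  rw [inner_diagonalOp, inner_smul_right]
  rcases eq_or_ne j i with rfl | hji
  · rfl
  · rw [e.orthonormal.2 hji, mul_zero, mul_zero]

theorem inner_diagonalOp_left (a : lp (fun _ : ι => 𝕜) ∞) (x y : H) :
    inner 𝕜 (diagonalOp e a x) y = inner 𝕜 x (diagonalOp e (star a) y) := by
  rw [← e.tsum_inner_mul_inner, ← e.tsum_inner_mul_inner]
  refine tsum_congr fun i => ?_
  rw [← inner_conj_symm, inner_diagonalOp, inner_diagonalOp, map_mul, inner_conj_symm,
    lp.star_apply, RCLike.star_def]
  ring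

end DiagonalOperator

section PositiveSqrt

variable {ι H : Type*} [NormedAddCommGroup H] [InnerProductSpace ℝ H]

theorem isSymmetric_diagonalOp (e : HilbertBasis ι ℝ H) (a : lp (fun _ : ι => ℝ) ∞) :
    (diagonalOp e a).IsSymmetric := fun x y => by
  have hstar : star a = a := lp.ext (funext fun i => star_trivial (a i))
  exact (inner_diagonalOp_left e a x y).trans (by rw [hstar]; rfl)

theorem isPositive_diagonalOp (e : HilbertBasis ι ℝ H) {a : lp (fun _ : ι => ℝ) ∞}
    (ha : ∀ i, 0 ≤ a i) : (diagonalOp e a).IsPositive := by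
  refine ⟨isSymmetric_diagonalOp e a, fun x => ?_⟩
  rw [ContinuousLinearMap.reApplyInnerSelf_apply, RCLike.re_to_real, ← e.tsum_inner_mul_inner]
  refine tsum_nonneg fun i => ?_
  rw [real_inner_comm, inner_diagonalOp, mul_assoc]
  exact mul_nonneg (ha i) (mul_self_nonneg _)

namespace IsPositiveSqrt

variable {Q R : H →L[ℝ] H}

theorem apply_apply (hR : IsPositiveSqrt Q R) (x : H) : R (R x) = Q x :=
  DFunLike.congr_fun hR.2 x

theorem apply_eq_zero (hR : IsPositiveSqrt Q R) {x : H} (hx : Q x = 0) : R x = 0 := by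
  have hsymm : inner ℝ (R x) (R x) = inner ℝ x (R (R x)) := hR.1.1 x (R x)
  rwa [hR.apply_apply, hx, inner_zero_right, inner_self_eq_zero] at hsymm

theorem apply_eq_smul (hR : IsPositiveSqrt Q R) {x : H} {s : ℝ} (hs : 0 ≤ s)
    (hx : Q x = s ^ 2 • x) : R x = s • x := by
  rcases hs.eq_or_lt with rfl | hs
  · rw [hR.apply_eq_zero (by rw [hx, zero_pow two_ne_zero, zero_smul]), zero_smul]
  -- `R x - s • x` is an eigenvector for the negative eigenvalue `-s`, hence zero
  · have heigen : R (R x - s • x) = -(s • (R x - s • x)) := by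
      rw [map_sub, map_smul, hR.apply_apply, hx, smul_sub, smul_smul, sq]
      abel
    have hnonneg : 0 ≤ inner ℝ (R (R x - s • x)) (R x - s • x) := hR.1.2 _
    rw [heigen, inner_neg_left, real_inner_smul_left, neg_nonneg] at hnonneg
    exact sub_eq_zero.1 (real_inner_self_nonpos.1 (nonpos_of_mul_nonpos_right hnonneg hs))

end IsPositiveSqrt

theorem existsUnique_isPositiveSqrt (e : HilbertBasis ι ℝ H) {Q : H →L[ℝ] H} {σ : ι → ℝ}
    (hσ : ∀ i, 0 ≤ σ i) (hQ : ∀ i, Q (e i) = σ i ^ 2 • e i) :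
    ∃! R : H →L[ℝ] H, IsPositiveSqrt Q R := by
  have hbdd : ∀ i, ‖σ i‖ ≤ √‖Q‖ := fun i => by
    have h := Q.le_opNorm (e i)
    rw [hQ, norm_smul, e.orthonormal.1, mul_one, mul_one, norm_pow] at h
    exact Real.le_sqrt_of_sq_le h
  let s : lp (fun _ : ι => ℝ) ∞ := ⟨σ, memℓp_infty ⟨√‖Q‖, Set.forall_mem_range.2 hbdd⟩⟩
  have hs : ∀ i, diagonalOp e s (e i) = σ i • e i := diagonalOp_apply_basis e s
  refine ⟨diagonalOp e s, ⟨isPositive_diagonalOp e hσ, ?_⟩, fun R hR => ?_⟩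
  · refine continuousLinearMap_ext_hilbertBasis e fun i => ?_
    rw [ContinuousLinearMap.comp_apply, hs, map_smul, hs, hQ, smul_smul, sq]
  · refine continuousLinearMap_ext_hilbertBasis e fun i => ?_
    rw [hR.apply_eq_smul (hσ i) (hQ i), hs]

end PositiveSqrt

theorem memℓp_two_iff_summable_sq {ι : Type*} {a : ι → ℝ} :
    Memℓp a 2 ↔ Summable fun i => a i ^ 2 := by
  rw [memℓp_gen_iff (by norm_num)]
  simp

theorem summable_mul_sq_of_summable_rpow {ι : Type*} {a b : ι → ℝ} {p : ℝ} (ha : ∀ i, 0 ≤ a i)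
    (hb : ∀ i, 0 ≤ b i) (hp₀ : 0 < p) (hp₂ : p ≤ 2) (h : Summable fun i => a i ^ p * b i ^ p) :
    Summable fun i => (a i * b i) ^ 2 := by
  have hab (i : ι) : ‖a i * b i‖ ^ p = a i ^ p * b i ^ p := by
    rw [Real.norm_of_nonneg (mul_nonneg (ha i) (hb i)), Real.mul_rpow (ha i) (hb i)]
  have hmem : Memℓp (fun i => a i * b i) (ENNReal.ofReal p) := by
    refine (memℓp_gen_iff ?_).2 ?_
    · rwa [ENNReal.toReal_ofReal hp₀.le]
    · simpa only [ENNReal.toReal_ofReal hp₀.le, hab] using h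
  refine memℓp_two_iff_summable_sq.1 (hmem.of_exponent_ge ?_)
  exact ENNReal.ofReal_le_of_le_toReal (by simpa using hp₂)

/-- A bounded weight as an element of `ℓ^∞`, the type of entries of a diagonal operator. -/
noncomputable def BoundedWeight.toLp (ρ : BoundedWeight) : lp (fun _ : ℕ => ℝ) ∞ :=
  ⟨ρ.w, memℓp_infty <| ρ.bdd.imp fun _ hM => Set.forall_mem_range.2 fun n =>
    (Real.norm_of_nonneg (ρ.pos n).le).trans_le (hM n)⟩

namespace WeightedSpace

variable {H : Type*} [NormedAddCommGroup H] [InnerProductSpace ℝ H] (e : HilbertBasis ℕ ℝ H)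
  (ρ : BoundedWeight)

/-- The diagonal operator `e_n ↦ ρ_n e_n` of `H`, whose range is the weighted space. -/
noncomputable def weightOp : H →L[ℝ] H := diagonalOp e ρ.toLp

theorem inner_weightOp (x : H) (n : ℕ) :
    inner ℝ (e n) (weightOp e ρ x) = ρ.w n * inner ℝ (e n) x :=
  inner_diagonalOp e ρ.toLp x n

theorem weightOp_apply_basis (n : ℕ) : weightOp e ρ (e n) = ρ.w n • e n :=
  diagonalOp_apply_basis e ρ.toLp n

theorem weighted_inner_sq_weightOp (x : H) (n : ℕ) :
    (ρ.w n ^ 2)⁻¹ * |inner ℝ (weightOp e ρ x) (e n)| ^ 2 = inner ℝ x (e n) * inner ℝ x (e n) := by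
  have hρ := (ρ.pos n).ne'
  rw [sq_abs, real_inner_comm, inner_weightOp, real_inner_comm]
  field_simp

theorem weightOp_mem_weightedSubmodule (x : H) : weightOp e ρ x ∈ weightedSubmodule e ρ :=
  (hasSum_norm_sq e x).summable.congr fun n => (weighted_inner_sq_weightOp e ρ x n).symm

theorem exists_weightOp_eq (v : WeightedSpace e ρ) : ∃ x, weightOp e ρ x = incl e ρ v := by
  have hsum : Summable fun n => ((ρ.w n)⁻¹ * inner ℝ (e n) (incl e ρ v)) ^ 2 := by
    refine (summable_sq e ρ v).congr fun n => ?_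
    rw [sq_abs, real_inner_comm, mul_pow, inv_pow]
  obtain ⟨x, hx, -⟩ := exists_hasSum_smul_of_memℓp e (memℓp_two_iff_summable_sq.2 hsum)
  refine ⟨x, hilbertBasis_ext_inner e fun n => ?_⟩
  rw [inner_weightOp, hx, mul_inv_cancel_left₀ (ρ.pos n).ne']

/-- `weightOp` as an isometry of `H` onto the weighted space with its own norm. -/
noncomputable def weightEquiv : H ≃ₗᵢ[ℝ] WeightedSpace e ρ :=
  LinearIsometryEquiv.ofSurjective
    { toLinearMap := (weightOp e ρ).toLinearMap.codRestrict (weightedSubmodule e ρ)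
        (weightOp_mem_weightedSubmodule e ρ)
      norm_map' := fun x => by
        rw [← sq_eq_sq₀ (norm_nonneg _) (norm_nonneg _), ← real_inner_self_eq_norm_sq, inner_def,
          ← (hasSum_norm_sq e x).tsum_eq]
        refine tsum_congr fun n => ?_
        rw [← weighted_inner_sq_weightOp e ρ x n, sq_abs, sq (inner ℝ (weightOp e ρ x) (e n))]
        rfl }
    fun v => (exists_weightOp_eq e ρ v).imp fun _ hx => Subtype.ext hx

theorem incl_weightEquiv (x : H) : incl e ρ (weightEquiv e ρ x) = weightOp e ρ x := rfl

theorem completeSpace : CompleteSpace (WeightedSpace e ρ) :=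
  (e.repr.symm.trans (weightEquiv e ρ)).symm.toIsometryEquiv.completeSpace

theorem continuous_incl : Continuous (incl e ρ) := (inclL e ρ).continuous

theorem denseRange_incl : DenseRange (incl e ρ) := by
  have hspan : Submodule.span ℝ (Set.range e) ≤ LinearMap.range (incl e ρ) := by
    refine Submodule.span_le.2 (Set.range_subset_iff.2 fun n => ?_)
    refine ⟨(ρ.w n)⁻¹ • weightEquiv e ρ (e n), ?_⟩
    rw [map_smul, incl_weightEquiv, weightOp_apply_basis, inv_smul_smul₀ (ρ.pos n).ne']
  exact (Submodule.dense_iff_topologicalClosure_eq_top.2 e.dense_span).mono hspan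

theorem continuous_toDual : Continuous (toDual e ρ) :=
  (innerSL ℝ (E := H)).continuous.clm_comp continuous_const

theorem toDual_weightEquiv (h x : H) :
    toDual e ρ h (weightEquiv e ρ x) = inner ℝ (weightOp e ρ h) x :=
  (isSymmetric_diagonalOp e ρ.toLp h x).symm

theorem toDual_eq_innerSL_comp (h : H) : toDual e ρ h = (innerSL ℝ (weightOp e ρ h)).comp
    ((weightEquiv e ρ).symm.toContinuousLinearEquiv : WeightedSpace e ρ →L[ℝ] H) := by
  ext v
  obtain ⟨x, rfl⟩ := (weightEquiv e ρ).surjective v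
  rw [toDual_weightEquiv]
  exact congrArg _ ((weightEquiv e ρ).symm_apply_apply x).symm

theorem exists_tendsto_toDual_sum {a : ℕ → ℝ} (ha : Summable fun n => (ρ.w n * a n) ^ 2) :
    ∃ φ, Tendsto (fun N : ℕ => toDual e ρ (∑ n ∈ Finset.range N, a n • e n)) atTop (𝓝 φ) := by
  obtain ⟨g, -, hg⟩ := exists_hasSum_smul_of_memℓp e (memℓp_two_iff_summable_sq.2 ha)
  have hcont : Continuous fun x : H => (innerSL ℝ x).comp
      ((weightEquiv e ρ).symm.toContinuousLinearEquiv : WeightedSpace e ρ →L[ℝ] H) :=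
    (innerSL ℝ (E := H)).continuous.clm_comp continuous_const
  refine ⟨_, ((hcont.tendsto g).comp hg.tendsto_sum_nat).congr fun N => ?_⟩
  simp only [Function.comp_apply, toDual_eq_innerSL_comp, map_sum, map_smul, weightOp_apply_basis,
    smul_smul, mul_comm]

variable {e ρ}

theorem toDual_sum_apply_of_isPositiveSqrt {Q R : H →L[ℝ] H} {σ : ℕ → ℝ} (hR : IsPositiveSqrt Q R)
    (hσ : ∀ n, 0 ≤ σ n) (hQ : ∀ n, Q (e n) = σ n ^ 2 • e n) (x : ℕ → ℝ) (s : Finset ℕ)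
    (v : WeightedSpace e ρ) :
    toDual e ρ (∑ n ∈ s, (σ n * x n) • e n) v = ∑ n ∈ s, x n * inner ℝ (R (incl e ρ v)) (e n) := by
  change inner ℝ (∑ n ∈ s, (σ n * x n) • e n) (incl e ρ v) = _
  rw [sum_inner]
  refine Finset.sum_congr rfl fun n _ => ?_
  have hsymm : inner ℝ (R (incl e ρ v)) (e n) = inner ℝ (incl e ρ v) (R (e n)) := hR.1.1 _ _
  rw [hsymm, hR.apply_eq_smul (hσ n) (hQ n), real_inner_smul_left, real_inner_smul_right,
    real_inner_comm (e n)]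
  ring

end WeightedSpace

section LaplaceTransform

theorem eqOn_re_nonneg_of_eqOn_imaginary_axis {E : Type*} [NormedAddCommGroup E] [NormedSpace ℂ E]
    {f g : ℂ → E} {C : ℝ} (hf : DiffContOnCl ℂ f {z | 0 < z.re})
    (hg : DiffContOnCl ℂ g {z | 0 < z.re}) (hfC : ∀ z : ℂ, 0 ≤ z.re → ‖f z‖ ≤ C)
    (hgC : ∀ z : ℂ, 0 ≤ z.re → ‖g z‖ ≤ C) (him : ∀ x : ℝ, f (x * Complex.I) = g (x * Complex.I))
    {z : ℂ} (hz : 0 ≤ z.re) : f z = g z := by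
  have hbound : ∀ w : ℂ, 0 ≤ w.re → ‖(f - g) w‖ ≤ C + C := fun w hw =>
    (norm_sub_le _ _).trans (add_le_add (hfC w hw) (hgC w hw))
  have hgrowth : (f - g) =O[Bornology.cobounded ℂ ⊓ 𝓟 {w | 0 < w.re}]
      fun w => Real.exp (0 * ‖w‖ ^ (1 : ℝ)) := by
    refine Asymptotics.IsBigO.of_bound (C + C) ?_
    filter_upwards [mem_inf_of_right (mem_principal_self _)] with w hw
    simpa using hbound w (le_of_lt hw)
  have hreal : IsBoundedUnder (· ≤ ·) atTop fun x : ℝ => ‖(f - g) x‖ :=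
    isBoundedUnder_of_eventually_le ((eventually_ge_atTop 0).mono fun x hx => hbound x hx)
  have hzero : ‖(f - g) z‖ ≤ 0 :=
    PhragmenLindelof.right_half_plane_of_bounded_on_real (hf.sub hg) ⟨1, one_lt_two, 0, hgrowth⟩
      hreal (fun x => by simp [him]) hz
  exact sub_eq_zero.1 (norm_le_zero_iff.1 hzero)

theorem re_cpow_nonneg {α : ℝ} (hα₀ : 0 < α) (hα₁ : α ≤ 1) {w : ℂ} (hw : 0 ≤ w.re) :
    0 ≤ (w ^ (α : ℂ)).re := by
  have harg := abs_le.1 (Complex.abs_arg_le_pi_div_two_iff.2 hw)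
  rw [Complex.cpow_ofReal_re]
  exact mul_nonneg (by positivity)
    (Real.cos_nonneg_of_neg_pi_div_two_le_of_le (by nlinarith) (by nlinarith))

theorem ofReal_mul_I_cpow (α x : ℝ) :
    ((x : ℂ) * Complex.I) ^ (α : ℂ) = ((|x| ^ α : ℝ) : ℂ) *
      Complex.exp (((Real.sign x * (Real.pi * α / 2) : ℝ) : ℂ) * Complex.I) := by
  have harg : Complex.arg (x * Complex.I) * α = x.sign * (Real.pi * α / 2) := by
    rcases lt_trichotomy x 0 with hx | rfl | hx
    · rw [show (x : ℂ) * Complex.I = ((-x : ℝ) : ℂ) * -Complex.I by simp,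
        Complex.arg_real_mul _ (neg_pos.2 hx), Complex.arg_neg_I, Real.sign_of_neg hx]
      ring
    · simp
    · rw [Complex.arg_real_mul _ hx, Complex.arg_I, Real.sign_of_pos hx]; ring
  rw [Complex.cpow_ofReal, harg]
  simp [Complex.exp_mul_I]

theorem exp_sign_mul_I_eq {θ : ℝ} (hθ : Real.cos θ ≠ 0) {x : ℝ} (hx : x ≠ 0) :
    Complex.exp (((Real.sign x * θ : ℝ) : ℂ) * Complex.I) =
      (Real.cos θ : ℂ) * (1 + Complex.I * ((Real.tan θ * Real.sign x : ℝ) : ℂ)) := by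
  have hcos : (Real.cos θ : ℂ) ≠ 0 := by exact_mod_cast hθ
  rw [Real.tan_eq_sin_div_cos, Complex.exp_mul_I]
  push_cast at hcos ⊢
  rcases Real.sign_apply_eq_of_ne_zero x hx with h | h <;>
  · rw [h]
    field_simp
    simp [mul_comm Complex.I]

variable {Ω : Type*} [MeasurableSpace Ω] {P : Measure Ω} {X : Ω → ℝ}

theorem norm_cexp_neg_mul_le_one {w : ℂ} (hw : 0 ≤ w.re) {x : ℝ} (hx : 0 ≤ x) :
    ‖Complex.exp (-w * x)‖ ≤ 1 := by
  rw [Complex.norm_exp, Real.exp_le_one_iff]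
  simpa using mul_nonneg hw hx

theorem integrable_exp_neg_mul [IsFiniteMeasure P] (hX : AEMeasurable X P)
    (hX₀ : ∀ᵐ ω ∂P, 0 ≤ X ω) {u : ℝ} (hu : 0 ≤ u) :
    Integrable (fun ω => Real.exp (-u * X ω)) P := by
  refine Integrable.of_bound (C := 1) (by fun_prop) ?_
  filter_upwards [hX₀] with ω hω
  rw [Real.norm_eq_abs, Real.abs_exp, Real.exp_le_one_iff]
  simpa using mul_nonneg hu hω

theorem norm_complexMGF_neg_le_one [IsProbabilityMeasure P] (hX₀ : ∀ᵐ ω ∂P, 0 ≤ X ω) {w : ℂ}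
    (hw : 0 ≤ w.re) : ‖complexMGF X P (-w)‖ ≤ 1 :=
  (norm_integral_le_of_norm_le_const
    (hX₀.mono fun _ hω => norm_cexp_neg_mul_le_one hw hω)).trans_eq (by simp)

theorem diffContOnCl_complexMGF_neg [IsFiniteMeasure P] (hX : AEMeasurable X P)
    (hX₀ : ∀ᵐ ω ∂P, 0 ≤ X ω) :
    DiffContOnCl ℂ (fun w => complexMGF X P (-w)) {w | 0 < w.re} := by
  refine ⟨fun w hw => ?_, ?_⟩
  · have hsub : Set.Iic (0 : ℝ) ⊆ integrableExpSet X P := fun t ht => by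
      simpa [integrableExpSet] using integrable_exp_neg_mul hX hX₀ (neg_nonneg.2 ht)
    have hmem : (-w).re ∈ interior (integrableExpSet X P) :=
      interior_mono hsub (by simpa using hw)
    exact ((hasDerivAt_complexMGF hmem).differentiableAt.comp w
      differentiableAt_id.neg).differentiableWithinAt
  · rw [Complex.closure_setOfPred_lt_re]
    refine continuousOn_of_dominated (bound := fun _ => 1) (fun w _ => ?_)
      (fun w hw => hX₀.mono fun _ hω => norm_cexp_neg_mul_le_one hw hω) (integrable_const _)
      (.of_forall fun ω => by fun_prop)
    exact AEMeasurable.aestronglyMeasurable (by fun_prop)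

theorem norm_cexp_neg_mul_cpow_le_one {α : ℝ} (hα₀ : 0 < α) (hα₁ : α ≤ 1) {κ : ℝ} (hκ : 0 ≤ κ)
    {w : ℂ} (hw : 0 ≤ w.re) : ‖Complex.exp (-(κ * w ^ (α : ℂ)))‖ ≤ 1 := by
  rw [Complex.norm_exp, Real.exp_le_one_iff]
  simpa using mul_nonneg hκ (re_cpow_nonneg hα₀ hα₁ hw)

theorem diffContOnCl_cexp_neg_mul_cpow {α : ℝ} (hα : 0 < α) (κ : ℂ) :
    DiffContOnCl ℂ (fun w : ℂ => Complex.exp (-(κ * w ^ (α : ℂ)))) {w | 0 < w.re} := by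
  refine ⟨fun w hw => ?_, ?_⟩
  · have h : DifferentiableAt ℂ (fun w : ℂ => w ^ (α : ℂ)) w :=
      differentiableAt_id.cpow_const (Or.inl hw)
    exact (h.const_mul κ).neg.cexp.differentiableWithinAt
  · rw [Complex.closure_setOfPred_lt_re]
    intro w hw
    have h : ContinuousAt (fun w : ℂ => w ^ (α : ℂ)) w :=
      Complex.continuousAt_cpow_const_of_re_pos (Or.inl hw) (by simpa using hα)
    exact (continuousAt_const.mul h).neg.cexp.continuousWithinAt

theorem laplaceConst_nonneg {α c : ℝ} (hα₀ : -1 ≤ α) (hα₁ : α ≤ 1) (hc : 0 ≤ c) :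
    0 ≤ laplaceConst α c :=
  div_nonneg hc (Real.cos_nonneg_of_mem_Icc
    ⟨by nlinarith [Real.pi_pos], by nlinarith [Real.pi_pos]⟩)

theorem cexp_neg_laplaceConst_mul_cpow {α c : ℝ} (hα : α ≠ 0)
    (hcos : Real.cos (Real.pi * α / 2) ≠ 0) (x : ℝ) :
    Complex.exp (-(laplaceConst α c * (x * Complex.I) ^ (α : ℂ))) =
      Complex.exp (-((c * |x| ^ α : ℝ) : ℂ) *
        (1 + Complex.I * ((Real.tan (Real.pi * α / 2) * Real.sign x : ℝ) : ℂ))) := by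
  rcases eq_or_ne x 0 with rfl | hx
  · simp [hα, Complex.zero_cpow]
  · have hcos' : (Real.cos (Real.pi * α / 2) : ℂ) ≠ 0 := by exact_mod_cast hcos
    rw [ofReal_mul_I_cpow, exp_sign_mul_I_eq hcos hx, laplaceConst, Complex.ofReal_div,
      Complex.ofReal_mul]
    congr 1
    push_cast at hcos' ⊢
    field_simp

theorem mgf_neg_eq_of_charFun_eq [IsProbabilityMeasure P] {α c : ℝ} (hα₀ : 0 < α) (hα₁ : α < 1)
    (hc : 0 ≤ c) (hX : AEMeasurable X P) (hX₀ : ∀ᵐ ω ∂P, 0 ≤ X ω)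
    (hchar : ∀ u : ℝ, charFun (P.map X) u =
      Complex.exp (-((c * |u| ^ α : ℝ) : ℂ) *
        (1 - Complex.I * ((Real.tan (Real.pi * α / 2) * Real.sign u : ℝ) : ℂ))))
    {u : ℝ} (hu : 0 ≤ u) : mgf X P (-u) = Real.exp (-(laplaceConst α c * u ^ α)) := by
  have hcos : 0 < Real.cos (Real.pi * α / 2) :=
    Real.cos_pos_of_mem_Ioo ⟨by nlinarith [Real.pi_pos], by nlinarith [Real.pi_pos]⟩
  have himag : ∀ x : ℝ, complexMGF X P (-(x * Complex.I)) =
      Complex.exp (-(laplaceConst α c * (x * Complex.I) ^ (α : ℂ))) := fun x => by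
    rw [cexp_neg_laplaceConst_mul_cpow hα₀.ne' hcos.ne',
      show -((x : ℂ) * Complex.I) = ((-x : ℝ) : ℂ) * Complex.I by simp, complexMGF_mul_I hX,
      hchar, abs_neg, Real.sign_neg]
    simp [sub_eq_add_neg]
  have hκ := laplaceConst_nonneg (by linarith : -1 ≤ α) hα₁.le hc
  have hext : complexMGF X P (-(u : ℂ)) =
      Complex.exp (-(laplaceConst α c * (u : ℂ) ^ (α : ℂ))) :=
    eqOn_re_nonneg_of_eqOn_imaginary_axis (f := fun w => complexMGF X P (-w)) (C := 1)
      (diffContOnCl_complexMGF_neg hX hX₀) (diffContOnCl_cexp_neg_mul_cpow hα₀ _)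
      (fun _ => norm_complexMGF_neg_le_one hX₀)
      (fun _ => norm_cexp_neg_mul_cpow_le_one hα₀ hα₁.le hκ) himag (by simpa using hu)
  rw [← Complex.ofReal_neg, complexMGF_ofReal, ← Complex.ofReal_cpow hu] at hext
  exact_mod_cast hext

end LaplaceTransform

section StableSubordinator

theorem addMonoidHom_apply_eq_mul_of_monotone (f : ℝ≥0 →+ ℝ) (hf : Monotone f) (t : ℝ≥0) :
    f t = t * f 1 := by
  have hnat (n : ℕ) (s : ℝ≥0) : f (n * s) = n * f s := by
    rw [← nsmul_eq_mul, map_nsmul, nsmul_eq_mul]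
  have hlower : ∀ᶠ n : ℕ in atTop, (⌊(t : ℝ) * n⌋₊ / n : ℝ) * f 1 ≤ f t := by
    filter_upwards [eventually_gt_atTop 0] with n hn
    have hle : (⌊(t : ℝ) * n⌋₊ : ℝ≥0) * 1 ≤ n * t := by
      rw [← NNReal.coe_le_coe]
      simpa [mul_comm] using Nat.floor_le (by positivity : (0 : ℝ) ≤ t * n)
    rw [div_mul_eq_mul_div, div_le_iff₀ (by positivity), ← hnat, mul_comm (f t), ← hnat]
    exact hf hle
  have hupper : ∀ᶠ n : ℕ in atTop, f t ≤ (⌈(t : ℝ) * n⌉₊ / n : ℝ) * f 1 := by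
    filter_upwards [eventually_gt_atTop 0] with n hn
    have hle : (n : ℝ≥0) * t ≤ ⌈(t : ℝ) * n⌉₊ * 1 := by
      rw [← NNReal.coe_le_coe]
      simpa [mul_comm] using Nat.le_ceil ((t : ℝ) * n)
    rw [div_mul_eq_mul_div, le_div_iff₀ (by positivity), ← hnat, mul_comm (f t), ← hnat]
    exact hf hle
  have hfloor := (tendsto_nat_floor_mul_div_atTop t.2).comp (tendsto_natCast_atTop_atTop (R := ℝ))
  have hceil := (tendsto_nat_ceil_mul_div_atTop t.2).comp (tendsto_natCast_atTop_atTop (R := ℝ))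
  exact le_antisymm (ge_of_tendsto (hceil.mul_const (f 1)) hupper)
    (le_of_tendsto (hfloor.mul_const (f 1)) hlower)

variable {Ω : Type*} [MeasurableSpace Ω] {P : Measure Ω} {L : ℝ≥0 → Ω → ℝ}

namespace IsLevyProcess

theorem mgf_add (hL : IsLevyProcess L P) (s t : ℝ≥0) (x : ℝ) :
    mgf (L (s + t)) P x = mgf (L s) P x * mgf (L t) P x := by
  have hs := hL.aemeasurable s
  have hst := hL.aemeasurable (s + t)
  have hindep : IndepFun (L s) (L (s + t) - L s) P :=
    hL.indep.indepFun_eval_sub zero_le (le_add_of_nonneg_right zero_le) hL.zero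
  have hlaw : mgf (L (s + t) - L s) P = mgf (L t) P := by
    rw [← mgf_id_map (hst.sub hs), ← mgf_id_map (hL.aemeasurable t), ← hL.stationary s t]
    rfl
  rw [← hlaw, ← hindep.mgf_add (by fun_prop) (by simp only [Pi.sub_apply]; fun_prop),
    add_sub_cancel]

theorem ae_nonneg_of_monotone (hL : IsLevyProcess L P)
    (hmono : ∀ᵐ ω ∂P, Monotone fun t => L t ω) (t : ℝ≥0) : ∀ᵐ ω ∂P, 0 ≤ L t ω := by
  filter_upwards [hL.zero, hmono] with ω h0 hm
  exact h0 ▸ hm zero_le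

theorem mgf_neg_eq_exp_of_monotone [IsProbabilityMeasure P] (hL : IsLevyProcess L P)
    (hmono : ∀ᵐ ω ∂P, Monotone fun t => L t ω) (t : ℝ≥0) {u : ℝ} (hu : 0 ≤ u) :
    mgf (L t) P (-u) = Real.exp (t * Real.log (mgf (L 1) P (-u))) := by
  have hint (s : ℝ≥0) : Integrable (fun ω => Real.exp (-u * L s ω)) P :=
    integrable_exp_neg_mul (hL.aemeasurable s) (hL.ae_nonneg_of_monotone hmono s) hu
  have hpos (s : ℝ≥0) : 0 < mgf (L s) P (-u) := mgf_pos (hint s)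
  let ψ : ℝ≥0 →+ ℝ := AddMonoidHom.mk' (fun s => -Real.log (mgf (L s) P (-u))) fun s r => by
    rw [hL.mgf_add, Real.log_mul (hpos s).ne' (hpos r).ne', neg_add]
  have hψ : Monotone ψ := fun s r hsr => by
    refine neg_le_neg (Real.log_le_log (hpos r) (integral_mono_ae (hint r) (hint s) ?_))
    filter_upwards [hmono] with ω hω
    exact Real.exp_le_exp.2 (mul_le_mul_of_nonpos_left (hω hsr) (neg_nonpos.2 hu))
  have hlin : -Real.log (mgf (L t) P (-u)) = t * -Real.log (mgf (L 1) P (-u)) :=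
    addMonoidHom_apply_eq_mul_of_monotone ψ hψ t
  rw [← Real.exp_log (hpos t)]
  congr 1
  linarith

end IsLevyProcess

namespace IsStableSubordinator

variable {α c : ℝ}

theorem ae_nonneg (hL : IsStableSubordinator α c L P) (t : ℝ≥0) : ∀ᵐ ω ∂P, 0 ≤ L t ω :=
  hL.levy.ae_nonneg_of_monotone hL.mono t

variable [IsProbabilityMeasure P]

theorem scale_nonneg (hL : IsStableSubordinator α c L P) : 0 ≤ c := by
  have : IsProbabilityMeasure (P.map (L 1)) :=
    Measure.isProbabilityMeasure_map (hL.levy.aemeasurable 1)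
  have hnorm := norm_charFun_le_one (μ := P.map (L 1)) 1
  rw [hL.charFun_one, Complex.norm_exp, Real.exp_le_one_iff] at hnorm
  simpa [-Complex.ofReal_tan] using hnorm

theorem mgf_neg_eq (hL : IsStableSubordinator α c L P) (hα₀ : 0 < α) (hα₁ : α < 1) (t : ℝ≥0)
    {u : ℝ} (hu : 0 ≤ u) : mgf (L t) P (-u) = Real.exp (-(t * laplaceConst α c * u ^ α)) := by
  have hone := mgf_neg_eq_of_charFun_eq hα₀ hα₁ hL.scale_nonneg (hL.levy.aemeasurable 1)
    (hL.ae_nonneg 1) hL.charFun_one hu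
  rw [hL.levy.mgf_neg_eq_exp_of_monotone hL.mono t hu, hone, Real.log_exp]
  congr 1
  ring

end IsStableSubordinator

end StableSubordinator

section RandomTime

variable {T E Ω : Type*} [PseudoEMetricSpace T] [TopologicalSpace.SeparableSpace T] [Nonempty T]
  [MeasurableSpace T] [OpensMeasurableSpace T] [TopologicalSpace E] [Nonempty E]

/-- The value at `s` of the function on `T` that takes the values `p` along a fixed dense sequence,
as a limit along a sequence of points of finite range converging to `s`. This is meaningful when
`p` comes from a continuous function, and it is measurable in `(p, s)` jointly. -/
noncomputable def extendFromDenseSeq (p : ℕ → E) (s : T) : E :=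
  limUnder atTop fun k => p (SimpleFunc.nearestPtInd (TopologicalSpace.denseSeq T) k s)

theorem extendFromDenseSeq_denseSeq [T2Space E] {f : T → E} (hf : Continuous f) (s : T) :
    extendFromDenseSeq (fun k => f (TopologicalSpace.denseSeq T k)) s = f s := by
  have hnearest := SimpleFunc.tendsto_nearestPt (e := TopologicalSpace.denseSeq T)
    (TopologicalSpace.denseRange_denseSeq T s)
  exact ((hf.tendsto s).comp hnearest).limUnder_eq

variable [MeasurableSpace E] [BorelSpace E] [PolishSpace E]

theorem measurable_extendFromDenseSeq :
    Measurable fun q : (ℕ → E) × T => extendFromDenseSeq q.1 q.2 := by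
  have heval : Measurable fun q : (ℕ → E) × ℕ => q.1 q.2 :=
    measurable_from_prod_countable_left fun n => measurable_pi_apply n
  have happrox (k : ℕ) : Measurable fun q : (ℕ → E) × T =>
      q.1 (SimpleFunc.nearestPtInd (TopologicalSpace.denseSeq T) k q.2) :=
    heval.comp (measurable_fst.prodMk ((SimpleFunc.measurable _).comp measurable_snd))
  exact (StronglyMeasurable.limUnder fun k => (happrox k).stronglyMeasurable).measurable

variable [MeasurableSpace Ω] {P : Measure Ω} [IsProbabilityMeasure P]

theorem identDistrib_prodMk_of_indepFun {S S' : Type*} [MeasurableSpace S] [MeasurableSpace S']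
    {f : Ω → S} {g : Ω → S'} (hf : AEMeasurable f P) (hg : AEMeasurable g P)
    (hindep : IndepFun f g P) :
    IdentDistrib (fun ω => (f ω, g ω)) (fun q : Ω × Ω => (f q.1, g q.2)) P (P.prod P) := by
  have hf_law : HasLaw f (P.map f) P := ⟨hf, rfl⟩
  have hg_law : HasLaw g (P.map g) P := ⟨hg, rfl⟩
  exact (hindep.hasLaw_prod hf_law hg_law).identDistrib
    ((indepFun_prod₀ hf hg).hasLaw_prod (hf_law.comp measurePreserving_fst.hasLaw)
      (hg_law.comp measurePreserving_snd.hasLaw))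

variable {X : T → Ω → E} {τ : Ω → T}

theorem identDistrib_eval_of_indepFun (hX : ∀ s, AEMeasurable (X s) P)
    (hcont : ∀ᵐ ω ∂P, Continuous fun s => X s ω) (hτ : AEMeasurable τ P)
    (hindep : IndepFun τ (fun ω s => X s ω) P) :
    IdentDistrib (fun ω => X (τ ω) ω) (fun q : Ω × Ω => X (τ q.1) q.2) P (P.prod P) := by
  let path : Ω → ℕ → E := fun ω k => X (TopologicalSpace.denseSeq T k) ω
  have hpath : AEMeasurable path P := aemeasurable_pi_lambda _ fun k => hX _
  have heval : ∀ᵐ ω ∂P, ∀ s, extendFromDenseSeq (path ω) s = X s ω := by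
    filter_upwards [hcont] with ω hω using extendFromDenseSeq_denseSeq hω
  have hindep' : IndepFun τ path P :=
    hindep.comp (φ := id) (ψ := fun (x : T → E) k => x (TopologicalSpace.denseSeq T k))
      measurable_id (by fun_prop)
  have hlaw := (identDistrib_prodMk_of_indepFun hτ hpath hindep').comp
    (measurable_extendFromDenseSeq.comp measurable_swap)
  have hfst : (fun ω => extendFromDenseSeq (path ω) (τ ω)) =ᵐ[P] fun ω => X (τ ω) ω := by
    filter_upwards [heval] with ω hω using hω (τ ω)
  have hsnd : (fun q : Ω × Ω => extendFromDenseSeq (path q.2) (τ q.1)) =ᵐ[P.prod P]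
      fun q => X (τ q.1) q.2 := by
    filter_upwards [Measure.quasiMeasurePreserving_snd.ae heval] with q hq using hq (τ q.1)
  exact ((IdentDistrib.of_ae_eq hlaw.aemeasurable_fst hfst).symm.trans hlaw).trans
    (.of_ae_eq hlaw.aemeasurable_snd hsnd)

theorem lintegral_eval_eq_lintegral_lintegral (hX : ∀ s, AEMeasurable (X s) P)
    (hcont : ∀ᵐ ω ∂P, Continuous fun s => X s ω) (hτ : AEMeasurable τ P)
    (hindep : IndepFun τ (fun ω s => X s ω) P) {g : E → ℝ≥0∞} (hg : Measurable g) :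
    ∫⁻ ω, g (X (τ ω) ω) ∂P = ∫⁻ ω, ∫⁻ ω', g (X (τ ω) ω') ∂P ∂P := by
  have hlaw := (identDistrib_eval_of_indepFun hX hcont hτ hindep).comp hg
  rw [← lintegral_prod (fun q : Ω × Ω => g (X (τ q.1) q.2)) hlaw.aemeasurable_snd]
  exact hlaw.lintegral_eq

theorem ae_eval_mem_of_indepFun (hX : ∀ s, AEMeasurable (X s) P)
    (hcont : ∀ᵐ ω ∂P, Continuous fun s => X s ω) (hτ : AEMeasurable τ P)
    (hindep : IndepFun τ (fun ω s => X s ω) P) {A : Set E} (hA : MeasurableSet A)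
    (hXA : ∀ s, ∀ᵐ ω ∂P, X s ω ∈ A) : ∀ᵐ ω ∂P, X (τ ω) ω ∈ A := by
  have hind : Measurable (Aᶜ.indicator (1 : E → ℝ≥0∞)) := measurable_one.indicator hA.compl
  have hzero : ∫⁻ ω, Aᶜ.indicator (1 : E → ℝ≥0∞) (X (τ ω) ω) ∂P = 0 := by
    rw [lintegral_eval_eq_lintegral_lintegral hX hcont hτ hindep hind]
    simp only [fun s => lintegral_congr_ae ((hXA s).mono fun ω hω => show
      Aᶜ.indicator (1 : E → ℝ≥0∞) (X s ω) = 0 by simp [hω]), lintegral_zero]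
  have hmeas := (identDistrib_eval_of_indepFun hX hcont hτ hindep).aemeasurable_fst
  filter_upwards [(lintegral_eq_zero_iff' (hind.comp_aemeasurable hmeas)).1 hzero] with ω hω
  by_contra hmem
  simp [hmem] at hω

theorem charFun_map_eval_of_indepFun {X : T → Ω → ℝ} (hX : ∀ s, AEMeasurable (X s) P)
    (hcont : ∀ᵐ ω ∂P, Continuous fun s => X s ω) (hτ : AEMeasurable τ P)
    (hindep : IndepFun τ (fun ω s => X s ω) P) (u : ℝ) :
    charFun (P.map fun ω => X (τ ω) ω) u = ∫ ω, charFun (P.map (X (τ ω))) u ∂P := by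
  have hlaw := identDistrib_eval_of_indepFun hX hcont hτ hindep
  have hmeas := hlaw.aemeasurable_snd
  have hexp : Measurable fun x : ℝ => Complex.exp (u * x * Complex.I) := by fun_prop
  have hint : Integrable (fun q : Ω × Ω => Complex.exp (u * X (τ q.1) q.2 * Complex.I))
      (P.prod P) := by
    refine Integrable.of_bound (C := 1) (hexp.comp_aemeasurable hmeas).aestronglyMeasurable
      (.of_forall fun q => ?_)
    rw [← Complex.ofReal_mul, Complex.norm_exp_ofReal_mul_I]
  simp only [charFun_apply_real]
  rw [hlaw.map_eq, integral_map hmeas hexp.aestronglyMeasurable, integral_prod _ hint]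
  exact integral_congr_ae (.of_forall fun ω =>
    (integral_map (hX (τ ω)) hexp.aestronglyMeasurable).symm)

end RandomTime

section SymmetricStable

theorem map_neg_eq_of_charFun_neg {ν : Measure ℝ} [IsFiniteMeasure ν]
    (hν : ∀ u, charFun ν (-u) = charFun ν u) : ν.map (fun x => -x) = ν := by
  refine Measure.ext_of_charFun (funext fun u => ?_)
  simpa only [neg_one_mul, hν] using charFun_map_mul (μ := ν) (-1) u

theorem isSymmetricStable_of_charFun_eq {a k : ℝ} (ha : a ≠ 0) {ν : Measure ℝ}
    [IsProbabilityMeasure ν]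
    (hν : ∀ u : ℝ, charFun ν u = ((Real.exp (-(k * |u| ^ a)) : ℝ) : ℂ)) :
    IsSymmetricStable a ν where
  symm := map_neg_eq_of_charFun_neg fun u => by rw [hν, hν, abs_neg]
  stable A B hA hB := by
    refine ⟨0, Measure.ext_of_charFun (funext fun u => ?_)⟩
    have hscale (C : ℝ) (hC : 0 < C) : charFun (ν.map fun x => C * x) u =
        ((Real.exp (-(C ^ a * (k * |u| ^ a))) : ℝ) : ℂ) := by
      rw [charFun_map_mul, hν, abs_mul, abs_of_pos hC, Real.mul_rpow hC.le (abs_nonneg u),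
        mul_left_comm]
    have hAB : 0 < A ^ a + B ^ a := by positivity
    have hroot : ((A ^ a + B ^ a) ^ (1 / a)) ^ a = A ^ a + B ^ a := by
      rw [one_div, Real.rpow_inv_rpow hAB.le ha]
    simp only [add_zero]
    rw [charFun_conv, hscale A hA, hscale B hB, hscale _ (by positivity), hroot,
      ← Complex.ofReal_mul, ← Real.exp_add, add_mul, neg_add]

end SymmetricStable

section BrownianFamily

variable {Ω ι : Type*} [MeasurableSpace Ω] {P : Measure Ω}

theorem lintegral_sq_eq_of_isPreBrownianReal {B : ℝ≥0 → Ω → ℝ} (hB : IsPreBrownianReal B P)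
    (s : ℝ≥0) : ∫⁻ ω, ENNReal.ofReal (B s ω ^ 2) ∂P = s := by
  have hlaw := hB.hasLaw_eval s
  have hvar : ∫ ω, B s ω ^ 2 ∂P = s := by
    rw [← variance_of_integral_eq_zero (hB.aemeasurable s) (hB.integral_eval s),
      hlaw.variance_eq, variance_id_gaussianReal]
  rw [← ofReal_integral_eq_lintegral_ofReal hlaw.hasGaussianLaw.memLp_two.integrable_sq
    (.of_forall fun ω => sq_nonneg _), hvar, ENNReal.ofReal_coe_nnreal]

variable {β : ι → ℝ≥0 → Ω → ℝ}

theorem ae_tsum_sq_ne_top [Countable ι] (hβ : ∀ i, IsPreBrownianReal (β i) P) {b : ι → ℝ}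
    (hb : Summable fun i => b i ^ 2) (s : ℝ≥0) :
    ∀ᵐ ω ∂P, ∑' i, ENNReal.ofReal ((b i * β i s ω) ^ 2) ≠ ∞ := by
  have hmeas (i : ι) : AEMeasurable (fun ω => ENNReal.ofReal ((b i * β i s ω) ^ 2)) P := by
    have := (hβ i).aemeasurable s
    fun_prop
  have hterm (i : ι) : ∫⁻ ω, ENNReal.ofReal ((b i * β i s ω) ^ 2) ∂P =
      ENNReal.ofReal (b i ^ 2) * s := by
    rw [← lintegral_sq_eq_of_isPreBrownianReal (hβ i) s,
      ← lintegral_const_mul' _ _ ENNReal.ofReal_ne_top]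
    simp only [mul_pow, ENNReal.ofReal_mul (sq_nonneg _)]
  have hfinite : ∫⁻ ω, ∑' i, ENNReal.ofReal ((b i * β i s ω) ^ 2) ∂P ≠ ∞ := by
    rw [lintegral_tsum hmeas]
    simp only [hterm, ENNReal.tsum_mul_right]
    exact ENNReal.mul_ne_top hb.tsum_ofReal_ne_top ENNReal.coe_ne_top
  exact (ae_lt_top' (AEMeasurable.tsum hmeas) hfinite).mono fun _ hω => hω.ne

theorem charFun_map_sum_brownian [IsProbabilityMeasure P]
    (hβ : ∀ i, IsPreBrownianReal (β i) P) (hβindep : iIndepFun (fun i ω t => β i t ω) P)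
    (a : ι → ℝ) (I : Finset ι) (s : ℝ≥0) (u : ℝ) :
    charFun (P.map fun ω => ∑ i ∈ I, β i s ω * a i) u =
      ((Real.exp (-(u ^ 2 * (∑ i ∈ I, a i ^ 2) / 2) * s) : ℝ) : ℂ) := by
  have hmeas (i : ι) : AEMeasurable (β i s) P := (hβ i).aemeasurable s
  have hindep : iIndepFun (fun (i : I) ω => β i s ω * a i) P :=
    (hβindep.comp (fun i (x : ℝ≥0 → ℝ) => x s * a i) fun i => by fun_prop).precomp
      Subtype.val_injective
  have hterm (i : ι) : charFun (P.map fun ω => β i s ω * a i) u =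
      ((Real.exp (-(u ^ 2 * a i ^ 2 / 2) * s) : ℝ) : ℂ) := by
    simp only [mul_comm _ (a i)]
    rw [charFun_map_mul_comp (hmeas i), ((hβ i).hasLaw_eval s).map_eq, charFun_gaussianReal]
    push_cast
    congr 1
    ring
  rw [iIndepFun.charFun_map_fun_finsetSum_eq_prod (fun i _ => (hmeas i).mul_const _) hindep,
    Finset.prod_apply]
  simp only [hterm]
  rw [← Complex.ofReal_prod, ← Real.exp_sum, ← Finset.sum_mul, Finset.sum_neg_distrib,
    ← Finset.sum_div, Finset.mul_sum]

variable [IsProbabilityMeasure P] {τ : Ω → ℝ≥0}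

theorem aemeasurable_brownian_randomTime {B : ℝ≥0 → Ω → ℝ} (hB : IsBrownianReal B P)
    (hτ : AEMeasurable τ P) (hindep : IndepFun τ (fun ω s => B s ω) P) :
    AEMeasurable (fun ω => B (τ ω) ω) P :=
  (identDistrib_eval_of_indepFun hB.aemeasurable hB.cont hτ hindep).aemeasurable_fst

theorem ae_summable_sq_randomTime [Countable ι] (hβ : ∀ i, IsBrownianReal (β i) P)
    (hτ : AEMeasurable τ P) (hindep : IndepFun τ (fun ω i s => β i s ω) P) {b : ι → ℝ}
    (hb : Summable fun i => b i ^ 2) : ∀ᵐ ω ∂P, Summable fun i => (b i * β i (τ ω) ω) ^ 2 := by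
  have hcont : ∀ᵐ ω ∂P, Continuous fun s i => β i s ω := by
    filter_upwards [ae_all_iff.2 fun i => (hβ i).cont] with ω hω using continuous_pi hω
  have hindep' : IndepFun τ (fun ω s i => β i s ω) P :=
    hindep.comp (φ := id) (ψ := fun (x : ι → ℝ≥0 → ℝ) s i => x i s) measurable_id (by fun_prop)
  have hmem := ae_eval_mem_of_indepFun (X := fun s ω i => β i s ω)
    (A := {x | ∑' i, ENNReal.ofReal ((b i * x i) ^ 2) ≠ ∞})
    (fun s => aemeasurable_pi_lambda _ fun i => (hβ i).aemeasurable s) hcont hτ hindep'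
    (measurableSet_eq_fun (by fun_prop) measurable_const).compl
    (fun s => ae_tsum_sq_ne_top (fun i => (hβ i).toIsPreBrownianReal) hb s)
  filter_upwards [hmem] with ω hω
  simpa only [ENNReal.toReal_ofReal (sq_nonneg _)] using ENNReal.summable_toReal hω

theorem charFun_map_sum_randomTime (hβ : ∀ i, IsBrownianReal (β i) P)
    (hβindep : iIndepFun (fun i ω t => β i t ω) P) (hτ : AEMeasurable τ P)
    (hindep : IndepFun τ (fun ω i s => β i s ω) P) (a : ι → ℝ) (I : Finset ι) (u : ℝ) :
    charFun (P.map fun ω => ∑ i ∈ I, β i (τ ω) ω * a i) u =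
      (mgf (fun ω => (τ ω : ℝ)) P (-(u ^ 2 * (∑ i ∈ I, a i ^ 2) / 2)) : ℂ) := by
  have hcont : ∀ᵐ ω ∂P, Continuous fun s => ∑ i ∈ I, β i s ω * a i := by
    filter_upwards [(Finset.eventually_all I).2 fun i _ => (hβ i).cont] with ω hω
    exact continuous_finsetSum _ fun i hi => (hω i hi).mul_const _
  have hindep' : IndepFun τ (fun ω s => ∑ i ∈ I, β i s ω * a i) P :=
    hindep.comp (φ := id) (ψ := fun (x : ι → ℝ≥0 → ℝ) s => ∑ i ∈ I, x i s * a i) measurable_id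
      (by fun_prop)
  rw [charFun_map_eval_of_indepFun (X := fun s ω => ∑ i ∈ I, β i s ω * a i)
    (fun s => Finset.aemeasurable_fun_sum _ fun i _ => ((hβ i).aemeasurable s).mul_const _)
    hcont hτ hindep']
  simp only [charFun_map_sum_brownian (fun i => (hβ i).toIsPreBrownianReal) hβindep,
    integral_complex_ofReal]
  rfl

end BrownianFamily

section SubordinatedFamily

variable {Ω : Type*} [MeasurableSpace Ω] {P : Measure Ω} {ι : Type*}
  {β : ι → ℝ≥0 → Ω → ℝ} {L : ℝ≥0 → Ω → ℝ} {α c : ℝ}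

theorem indepFun_toNNReal_eval (hβL : IndepFun (fun ω i t => β i t ω) (fun ω t => L t ω) P)
    (t : ℝ≥0) : IndepFun (fun ω => (L t ω).toNNReal) (fun ω i s => β i s ω) P :=
  hβL.symm.comp (φ := fun l : ℝ≥0 → ℝ => (l t).toNNReal) (ψ := id) (by fun_prop) measurable_id

variable [IsProbabilityMeasure P]

theorem aemeasurable_subordinate (hβ : ∀ i, IsBrownianReal (β i) P)
    (hβL : IndepFun (fun ω i t => β i t ω) (fun ω t => L t ω) P) {t : ℝ≥0}
    (hL : AEMeasurable (L t) P) (i : ι) :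
    AEMeasurable (subordinate (β i) L t) P :=
  aemeasurable_brownian_randomTime (B := β i) (hβ i) hL.real_toNNReal <|
    (indepFun_toNNReal_eval hβL t).comp (φ := id) (ψ := fun x : ι → ℝ≥0 → ℝ => x i)
      measurable_id (measurable_pi_apply i)

theorem aemeasurable_sum_subordinate (hβ : ∀ i, IsBrownianReal (β i) P)
    (hβL : IndepFun (fun ω i t => β i t ω) (fun ω t => L t ω) P) {t : ℝ≥0}
    (hL : AEMeasurable (L t) P) (a : ι → ℝ) (I : Finset ι) :
    AEMeasurable (fun ω => ∑ i ∈ I, subordinate (β i) L t ω * a i) P :=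
  Finset.aemeasurable_fun_sum _ fun i _ => (aemeasurable_subordinate hβ hβL hL i).mul_const _

theorem charFun_map_sum_subordinate (hα₀ : 0 < α) (hα₁ : α < 1)
    (hβ : ∀ i, IsBrownianReal (β i) P) (hβindep : iIndepFun (fun i ω t => β i t ω) P)
    (hL : IsStableSubordinator α c L P)
    (hβL : IndepFun (fun ω i t => β i t ω) (fun ω t => L t ω) P) (a : ι → ℝ) (I : Finset ι)
    (t : ℝ≥0) (u : ℝ) :
    charFun (P.map fun ω => ∑ i ∈ I, subordinate (β i) L t ω * a i) u =
      ((Real.exp (-(t * (laplaceConst α c / 2 ^ α) * (∑ i ∈ I, a i ^ 2) ^ α *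
        |u| ^ (2 * α))) : ℝ) : ℂ) := by
  have hA : 0 ≤ ∑ i ∈ I, a i ^ 2 := by positivity
  have hmgf (x : ℝ) : mgf (fun ω => ((L t ω).toNNReal : ℝ)) P x = mgf (L t) P x := by
    refine mgf_congr ?_
    filter_upwards [hL.ae_nonneg t] with ω hω using Real.coe_toNNReal _ hω
  have hpow : (u ^ 2 * (∑ i ∈ I, a i ^ 2) / 2) ^ α =
      |u| ^ (2 * α) * (∑ i ∈ I, a i ^ 2) ^ α / 2 ^ α := by
    rw [Real.div_rpow (by positivity) zero_le_two, Real.mul_rpow (sq_nonneg u) hA, ← sq_abs u,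
      ← Real.rpow_two, ← Real.rpow_mul (abs_nonneg u)]
  refine (charFun_map_sum_randomTime hβ hβindep (hL.levy.aemeasurable t).real_toNNReal
    (indepFun_toNNReal_eval hβL t) a I u).trans ?_
  rw [hmgf, hL.mgf_neg_eq hα₀ hα₁ t (by positivity), hpow]
  congr 3
  ring

theorem exists_tendstoInDistribution_sum_subordinate {β : ℕ → ℝ≥0 → Ω → ℝ} (hα₀ : 0 < α)
    (hα₁ : α < 1) (hβ : ∀ n, IsBrownianReal (β n) P)
    (hβindep : iIndepFun (fun n ω t => β n t ω) P) (hL : IsStableSubordinator α c L P)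
    (hβL : IndepFun (fun ω n t => β n t ω) (fun ω t => L t ω) P) {a : ℕ → ℝ} {A : ℝ}
    (ha : HasSum (fun n => a n ^ 2) A) (t : ℝ≥0) :
    ∃ ν : ProbabilityMeasure ℝ,
      TendstoInDistribution
        (fun (N : ℕ) ω => ∑ n ∈ Finset.range N, subordinate (β n) L t ω * a n)
        atTop (id : ℝ → ℝ) (fun _ => P) (ν : Measure ℝ) ∧
      IsSymmetricStable (2 * α) (ν : Measure ℝ) ∧
      ∀ u : ℝ, charFun (ν : Measure ℝ) u =
        ((Real.exp (-(t * (laplaceConst α c / 2 ^ α) * A ^ α * |u| ^ (2 * α))) : ℝ) : ℂ) := by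
  have hmeas := aemeasurable_sum_subordinate hβ hβL (hL.levy.aemeasurable t)
  have hchar := charFun_map_sum_subordinate hα₀ hα₁ hβ hβindep hL hβL
  -- By `hchar`, the law of the one-term sum `√A β⁰_{L_t}` is the limit law.
  let ν : ProbabilityMeasure ℝ :=
    ⟨P.map fun ω => ∑ n ∈ {0}, subordinate (β n) L t ω * √A,
      Measure.isProbabilityMeasure_map (hmeas (fun _ => √A) {0})⟩
  have hν (u : ℝ) : charFun (ν : Measure ℝ) u =
      ((Real.exp (-(t * (laplaceConst α c / 2 ^ α) * A ^ α * |u| ^ (2 * α))) : ℝ) : ℂ) := by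
    refine (hchar (fun _ => √A) {0} t u).trans ?_
    rw [Finset.sum_singleton, Real.sq_sqrt (ha.nonneg fun n => sq_nonneg _)]
  refine ⟨ν, ⟨fun N => hmeas a _, aemeasurable_id, ?_⟩,
    isSymmetricStable_of_charFun_eq (by positivity) hν, hν⟩
  refine ProbabilityMeasure.tendsto_of_tendsto_charFun fun u => ?_
  simp only [ProbabilityMeasure.coe_mk, Measure.map_id, hν, hchar]
  have hcont : Continuous fun x : ℝ =>
      ((Real.exp (-(t * (laplaceConst α c / 2 ^ α) * x ^ α * |u| ^ (2 * α))) : ℝ) : ℂ) := by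
    have := Real.continuous_rpow_const hα₀.le
    fun_prop
  exact (hcont.tendsto A).comp ha.tendsto_sum_nat

theorem exists_tendsto_toDual_sum_subordinate {H : Type*} [NormedAddCommGroup H]
    [InnerProductSpace ℝ H] (e : HilbertBasis ℕ ℝ H) (ρ : BoundedWeight)
    {β : ℕ → ℝ≥0 → Ω → ℝ} (hβ : ∀ n, IsBrownianReal (β n) P)
    (hβL : IndepFun (fun ω n t => β n t ω) (fun ω t => L t ω) P) {t : ℝ≥0}
    (hL : AEMeasurable (L t) P) {σ : ℕ → ℝ} (hσ : Summable fun n => (ρ.w n * σ n) ^ 2) :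
    ∃ W : Ω → StrongDual ℝ (WeightedSpace e ρ), StronglyMeasurable W ∧
      ∀ᵐ ω ∂P, Tendsto
        (fun N : ℕ => WeightedSpace.toDual e ρ
          (∑ n ∈ Finset.range N, (σ n * subordinate (β n) L t ω) • e n)) atTop (𝓝 (W ω)) := by
  -- Instance search finds this for an abstract space but not for `WeightedSpace e ρ` itself.
  have hdual (E : Type _) [NormedAddCommGroup E] [NormedSpace ℝ E] :
      TopologicalSpace.PseudoMetrizableSpace (StrongDual ℝ E) := inferInstance
  have := hdual (WeightedSpace e ρ)
  refine exists_stronglyMeasurable_limit_of_tendsto_ae (fun N => ?_) ?_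
  · refine (WeightedSpace.continuous_toDual e ρ).comp_aestronglyMeasurable
      (Finset.aestronglyMeasurable_fun_sum _ fun n _ => ?_)
    exact ((aemeasurable_subordinate hβ hβL hL n).const_mul _).aestronglyMeasurable.smul_const _
  · filter_upwards [ae_summable_sq_randomTime hβ hL.real_toNNReal
      (indepFun_toNNReal_eval hβL t) hσ] with ω hω
    exact WeightedSpace.exists_tendsto_toDual_sum e ρ (hω.congr fun n => by rw [mul_assoc]; rfl)

end SubordinatedFamily

theorem mainTheorem6_general
    {H : Type*} [NormedAddCommGroup H] [InnerProductSpace ℝ H]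
    (e : HilbertBasis ℕ ℝ H)
    {Ω : Type*} [MeasurableSpace Ω] (P : Measure Ω) [IsProbabilityMeasure P]
    (α c : ℝ) (hα₀ : 0 < α) (hα₁ : α < 1)
    (β : ℕ → ℝ≥0 → Ω → ℝ) (L : ℝ≥0 → Ω → ℝ)
    (hβ : ∀ n, IsBrownianReal (β n) P)
    (hβindep : iIndepFun (fun n ω t => β n t ω) P)
    (hL : IsStableSubordinator α c L P)
    (hβL : IndepFun (fun ω n t => β n t ω) (fun ω t => L t ω) P) :
    (∀ u : ℝ, 0 ≤ u →
      ∫ ω, Real.exp (-(u * L 1 ω)) ∂P = Real.exp (-(laplaceConst α c * u ^ α))) ∧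
    (∀ (h : H) (t : ℝ≥0), ∃ ν : ProbabilityMeasure ℝ,
      TendstoInDistribution
        (fun (N : ℕ) ω => ∑ n ∈ Finset.range N, subordinate (β n) L t ω * inner ℝ h (e n))
        atTop (id : ℝ → ℝ) (fun _ => P) (ν : Measure ℝ) ∧
      IsSymmetricStable (2 * α) (ν : Measure ℝ) ∧
      ∀ u : ℝ, charFun (ν : Measure ℝ) u =
        ((Real.exp (-(t * (laplaceConst α c / 2 ^ α) * ‖h‖ ^ (2 * α) * |u| ^ (2 * α))) : ℝ) : ℂ)) ∧
    (∀ (Q : H →L[ℝ] H) (σ : ℕ → ℝ), (∀ n, 0 ≤ σ n) →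
      (∀ n, Q (e n) = (σ n) ^ 2 • e n) →
      ∀ ρ : BoundedWeight, Summable (fun n => (ρ.w n * σ n) ^ 2) →
      CompleteSpace (WeightedSpace e ρ) ∧
      Continuous (WeightedSpace.incl e ρ) ∧
      DenseRange (WeightedSpace.incl e ρ) ∧
      (∃! R : H →L[ℝ] H, IsPositiveSqrt Q R) ∧
      ∀ t : ℝ≥0, ∃ W : Ω → StrongDual ℝ (WeightedSpace e ρ),
        StronglyMeasurable W ∧
        (∀ᵐ ω ∂P, Tendsto
          (fun N : ℕ => WeightedSpace.toDual e ρ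
            (∑ n ∈ Finset.range N, (σ n * subordinate (β n) L t ω) • e n))
          atTop (𝓝 (W ω))) ∧
        (∀ R : H →L[ℝ] H, IsPositiveSqrt Q R → ∀ᵐ ω ∂P, ∀ v : WeightedSpace e ρ, Tendsto
          (fun N : ℕ => ∑ n ∈ Finset.range N,
            subordinate (β n) L t ω * inner ℝ (R (WeightedSpace.incl e ρ v)) (e n))
          atTop (𝓝 (W ω v)))) := by
  refine ⟨fun u hu => ?_, fun h t => ?_, fun Q σ hσ hQ ρ hρσ => ⟨WeightedSpace.completeSpace e ρ,
    WeightedSpace.continuous_incl e ρ, WeightedSpace.denseRange_incl e ρ,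
    existsUnique_isPositiveSqrt e hσ hQ, fun t => ?_⟩⟩
  · simpa only [mgf, neg_mul, NNReal.coe_one, one_mul] using hL.mgf_neg_eq hα₀ hα₁ 1 hu
  · have hnorm : (‖h‖ ^ 2) ^ α = ‖h‖ ^ (2 * α) := by
      rw [← Real.rpow_two, ← Real.rpow_mul (norm_nonneg h)]
    have hsum : HasSum (fun n => inner ℝ h (e n) ^ 2) (‖h‖ ^ 2) := by
      simpa only [sq] using WeightedSpace.hasSum_norm_sq e h
    simpa only [hnorm] using
      exists_tendstoInDistribution_sum_subordinate hα₀ hα₁ hβ hβindep hL hβL hsum t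
  · obtain ⟨W, hWmeas, hW⟩ :=
      exists_tendsto_toDual_sum_subordinate e ρ hβ hβL (hL.levy.aemeasurable t) hρσ
    refine ⟨W, hWmeas, hW, fun R hR => ?_⟩
    filter_upwards [hW] with ω hω v
    have heval : Continuous fun φ : StrongDual ℝ (WeightedSpace e ρ) => φ v :=
      (ContinuousLinearMap.apply ℝ ℝ v).continuous
    simpa only [Function.comp_def, WeightedSpace.toDual_sum_apply_of_isPositiveSqrt hR hσ hQ]
      using (heval.tendsto _).comp hω

theorem mainTheorem6
    {H : Type*} [NormedAddCommGroup H] [InnerProductSpace ℝ H] [CompleteSpace H]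
    (e : HilbertBasis ℕ ℝ H)
    {Ω : Type*} [MeasurableSpace Ω] (P : Measure Ω) [IsProbabilityMeasure P]
    (α c : ℝ) (hα₀ : 0 < α) (hα₁ : α < 1) (hc : 0 < c)
    (β : ℕ → ℝ≥0 → Ω → ℝ) (L : ℝ≥0 → Ω → ℝ)
    (hβ : ∀ n, IsBrownianReal (β n) P)
    (hβindep : iIndepFun (fun n ω t => β n t ω) P)
    (hL : IsStableSubordinator α c L P)
    (hβL : IndepFun (fun ω n t => β n t ω) (fun ω t => L t ω) P) :
    -- the meaning of the constant `c'`
    (∀ u : ℝ, 0 ≤ u →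
      ∫ ω, Real.exp (-(u * L 1 ω)) ∂P = Real.exp (-(laplaceConst α c * u ^ α))) ∧
    -- convergence in distribution of `∑ β^n_{L_t} ⟨h, e_n⟩`
    (∀ (h : H) (t : ℝ≥0), 0 < t → ∃ ν : ProbabilityMeasure ℝ,
      TendstoInDistribution
        (fun (N : ℕ) ω => ∑ n ∈ Finset.range N, subordinate (β n) L t ω * inner ℝ h (e n))
        atTop (id : ℝ → ℝ) (fun _ => P) (ν : Measure ℝ) ∧
      IsSymmetricStable (2 * α) (ν : Measure ℝ) ∧
      ∀ u : ℝ, charFun (ν : Measure ℝ) u =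
        ((Real.exp (-(t * (laplaceConst α c / 2 ^ α) * ‖h‖ ^ (2 * α) * |u| ^ (2 * α))) : ℝ) : ℂ)) ∧
    -- the space `V` and the `V'`-valued random variable `√Q W_{L_t}`
    (∀ (Q : H →L[ℝ] H) (σ : ℕ → ℝ), Q.IsPositive → (∀ n, 0 ≤ σ n) →
      (∀ n, Q (e n) = (σ n) ^ 2 • e n) →
      ∀ (ρ : BoundedWeight) (r : ℝ), 0 < r → r < α →
      Summable (fun n => (ρ.w n) ^ (2 * r) * (σ n) ^ (2 * r)) →
      CompleteSpace (WeightedSpace e ρ) ∧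
      Continuous (WeightedSpace.incl e ρ) ∧
      DenseRange (WeightedSpace.incl e ρ) ∧
      (∃! R : H →L[ℝ] H, IsPositiveSqrt Q R) ∧
      ∀ t : ℝ≥0, 0 < t → ∃ W : Ω → StrongDual ℝ (WeightedSpace e ρ),
        StronglyMeasurable W ∧
        (∀ᵐ ω ∂P, Tendsto
          (fun N : ℕ => WeightedSpace.toDual e ρ
            (∑ n ∈ Finset.range N, (σ n * subordinate (β n) L t ω) • e n))
          atTop (𝓝 (W ω))) ∧
        (∀ R : H →L[ℝ] H, IsPositiveSqrt Q R → ∀ᵐ ω ∂P, ∀ v : WeightedSpace e ρ, Tendsto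
          (fun N : ℕ => ∑ n ∈ Finset.range N,
            subordinate (β n) L t ω * inner ℝ (R (WeightedSpace.incl e ρ v)) (e n))
          atTop (𝓝 (W ω v)))) := by
  obtain ⟨hlaplace, hseries, hdual⟩ :=
    mainTheorem6_general e P α c hα₀ hα₁ β L hβ hβindep hL hβL
  refine ⟨hlaplace, fun h t _ => hseries h t, fun Q σ _ hσ hQ ρ r hr hrα hsum => ?_⟩
  obtain ⟨hcomplete, hcont, hdense, hsqrt, hW⟩ := hdual Q σ hσ hQ ρ <|
    summable_mul_sq_of_summable_rpow (fun n => (ρ.pos n).le) hσ (by linarith) (by linarith) hsum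
  exact ⟨hcomplete, hcont, hdense, hsqrt, fun t _ => hW t⟩
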